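/- **Setting.** Use $\hat f(\omega)=\int_{\mathbb R} e^{-2\pi i x\omega}f(x)\,dx$ and $\langle f,g\rangle=\int_{\mathbb R} f\,\overline g\,dx$. For $\alpha\in[0,1]$ define recursively $i_{\alpha;0}=0$, $s_{\alpha;0}=1$, $\beta_\alpha(0)=1$ and, for $p\ge 1$, $$i_{\alpha;p}=s_{\alpha;p-1},\qquad \beta_\alpha(p)=\lfloor i_{\alpha;p}^{\,\alpha}\rfloor,\qquad s_{\alpha;p}=i_{\alpha;p}+\beta_\alpha(p).$$ Put $I_{\alpha;p}=[i_{\alpha;p},s_{\alpha;p})\cap\mathbb Z$ for $p\ge 0$, and $I_{\alpha;p}=-I_{\alpha;-p}$, $\beta_\alpha(p)=\beta_\alpha(-p)$ for integers $p<0$. For $\mu,\nu>0$, $\varphi\in L^1(\mathbb R)\cap L^2(\mathbb R)$ and $p,k\in\mathbb Z$ let $$\Phi^\mu_{p;\alpha}(\omega)=\sum_{\eta\in\mu I_{\alpha;p}}\hat\varphi(\omega-\eta),\qquad \varphi^{\alpha}_{p,k}(t)=\frac1{\sqrt{\beta_\alpha(p)}}\sum_{\eta\in\mu I_{\alpha;p}}e^{2\pi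 i\eta\left(t-k\frac{\nu}{\beta_\alpha(p)}\right)}\varphi\Bigl(t-k\tfrac{\nu}{\beta_\alpha(p)}\Bigr),$$ let $D^\alpha(\mu,\nu,\varphi)=\{\varphi^\alpha_{p,k}\}_{(p,k)\in\mathbb Z^2}$, and let $S^{\alpha;\mu,\nu}f=\sum_{p,k}\langle f,\varphi^\alpha_{p,k}\rangle\,\varphi^\alpha_{p,k}$ be its frame operator. **Theorem.** Let $\varphi\in L^1(\mathbb R)\cap L^2(\mathbb R)$ satisfy $|\hat\varphi(\omega)|\le C_N(1+|\omega|)^{-N}$ for all $\omega\in\mathbb R$, for some real $N>2$ and some constant $C_N$. Let $\mu>0$ and $a,b>0$. Then there is $\nu_0>0$ such that for every $\alpha\in[0,1]$ for which $$a\le\sum_{p\in\mathbb Z}|\Phi^\mu_{p;\alpha}(\omega)|^2\le b\qquad\text{for all }\omega\in\mathbb R,$$ and for every $0<\nu<\nu_0$, the system $D^\alpha(\mu,\nu,\varphi)$ is a frame of $L^2(\mathbb R)$ with frame bounds $\frac{a}{2\nu}$ and $\frac{1}{\nu}\left(b+\frac a2\right)$: for every $f\in L^2(\mathbb R)$, $$\frac{a}{2\nu}\|f\|_2^2\le\sum_{p,k\in\mathbb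 Z}|\langle f,\varphi^\alpha_{p,k}\rangle|^2\le\frac1\nu\Bigl(b+\frac a2\Bigr)\|f\|_2^2 .$$ Moreover, for every $f\in L^2(\mathbb R)$ the series defining $S^{\alpha;\mu,\nu}f$ converges unconditionally in $L^2(\mathbb R)$, and $$\frac{a}{2\nu}\|f\|_2^2\le|\langle S^{\alpha;\mu,\nu}f,f\rangle|\le\frac1\nu\Bigl(b+\frac a2\Bigr)\|f\|_2^2 .$$ -/

import Mathlib

open MeasureTheory
open scoped FourierTransform

noncomputable section

namespace DOST

/-- Right endpoints `s_{α;p}`, `p ∈ ℕ`, of the `α`-partition of `ℕ`: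
`s_{α;0} = 1` and `s_{α;p} = i_{α;p} + ⌊i_{α;p} ^ α⌋` with `i_{α;p} = s_{α;p-1}` for `p ≥ 1`. -/
def rightEnd (α : ℝ) : ℕ → ℕ
  | 0 => 1
  | p + 1 => rightEnd α p + ⌊(rightEnd α p : ℝ) ^ α⌋₊

/-- Left endpoints `i_{α;p}`, `p ∈ ℕ`: `i_{α;0} = 0` and `i_{α;p} = s_{α;p-1}` for `p ≥ 1`. -/
def leftEnd (α : ℝ) : ℕ → ℕ
  | 0 => 0
  | p + 1 => rightEnd α p

/-- Widths `β_α(p)`, `p ∈ ℕ`: `β_α(0) = 1` and `β_α(p) = ⌊i_{α;p} ^ α⌋` for `p ≥ 1`. -/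
def width (α : ℝ) : ℕ → ℕ
  | 0 => 1
  | p + 1 => ⌊(leftEnd α (p + 1) : ℝ) ^ α⌋₊

/-- The width `β_α(p) = β_α(|p|)` for `p ∈ ℤ`. -/
def beta (α : ℝ) (p : ℤ) : ℕ := width α p.natAbs

/-- The frequency block `I_{α;p} ⊆ ℤ`: the integers in `[i_{α;p}, s_{α;p})` for `p ≥ 0`, and
`-I_{α;-p}` for `p < 0`. -/
def block (α : ℝ) (p : ℤ) : Finset ℤ :=
  if 0 ≤ p then Finset.Ico (leftEnd α p.natAbs : ℤ) (rightEnd α p.natAbs : ℤ)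
  else Finset.Ioc (-(rightEnd α p.natAbs : ℤ)) (-(leftEnd α p.natAbs : ℤ))

/-- `Φ^μ_{p;α}(ω) = ∑_{η ∈ μ I_{α;p}} φ̂(ω - η)`. -/
def Phi (φ : ℝ → ℂ) (μ α : ℝ) (p : ℤ) (ω : ℝ) : ℂ :=
  ∑ n ∈ block α p, 𝓕 φ (ω - μ * (n : ℝ))

/-- The function
`φ^α_{p,k}(t) = β_α(p)^{-1/2} ∑_{η ∈ μ I_{α;p}} e^{2π i η (t - k ν / β_α(p))} φ(t - k ν / β_α(p))`. -/
def atomFun (φ : ℝ → ℂ) (μ ν α : ℝ) (p k : ℤ) (t : ℝ) : ℂ :=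
  ((1 / Real.sqrt (beta α p : ℝ) : ℝ) : ℂ) *
    ∑ n ∈ block α p,
      Complex.exp (2 * Real.pi * Complex.I *
          (((μ * (n : ℝ)) * (t - (k : ℝ) * ν / (beta α p : ℝ)) : ℝ) : ℂ)) *
        φ (t - (k : ℝ) * ν / (beta α p : ℝ))

theorem memLp_atomFun {φ : ℝ → ℂ} (hφ : MemLp φ 2 volume) (μ ν α : ℝ) (p k : ℤ) :
    MemLp (atomFun φ μ ν α p k) 2 volume := by
  unfold atomFun
  refine MemLp.const_mul ?_ _
  refine memLp_finsetSum _ fun n _ => ?_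
  have h1 : MemLp (fun t : ℝ => φ (t - (k : ℝ) * ν / (beta α p : ℝ))) 2 volume :=
    hφ.comp_measurePreserving (measurePreserving_sub_right volume _)
  refine (memLp_congr_norm ?_ h1.1 ?_).mpr h1
  · refine AEStronglyMeasurable.mul ?_ h1.1
    exact (by fun_prop : Continuous _).aestronglyMeasurable
  · refine Filter.Eventually.of_forall fun t => ?_
    rw [norm_mul, mul_right_comm (2 * (Real.pi : ℂ)), ← Complex.ofReal_ofNat,
      ← Complex.ofReal_mul, ← Complex.ofReal_mul, Complex.norm_exp_ofReal_mul_I, one_mul]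

/-- The `α`-DOST system `D^α(μ, ν, φ)`, as a family in `L²(ℝ)` indexed by `(p, k) ∈ ℤ × ℤ`. -/
def system (φ : ℝ → ℂ) (hφ : MemLp φ 2 (volume : Measure ℝ)) (μ ν α : ℝ) (q : ℤ × ℤ) :
    Lp ℂ 2 (volume : Measure ℝ) :=
  (memLp_atomFun hφ μ ν α q.1 q.2).toLp (atomFun φ μ ν α q.1 q.2)

/-- The family `e` is a frame of the Hilbert space `H` with frame bounds `A` and `B`. -/
def IsFrame {ι H : Type*} [NormedAddCommGroup H] [InnerProductSpace ℂ H]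
    (e : ι → H) (A B : ℝ) : Prop :=
  0 < A ∧ 0 < B ∧ ∀ f : H,
    Summable (fun i => ‖inner ℂ (e i) f‖ ^ 2) ∧
    A * ‖f‖ ^ 2 ≤ ∑' i, ‖inner ℂ (e i) f‖ ^ 2 ∧
    ∑' i, ‖inner ℂ (e i) f‖ ^ 2 ≤ B * ‖f‖ ^ 2

/-- The frame operator `S f = ∑ i, ⟨f, e i⟩ e i`; the pairing `⟨f, g⟩ = ∫ f ḡ` of `L²`,
linear in `f`, is `inner ℂ g f`. -/
def frameOp {ι H : Type*} [NormedAddCommGroup H] [InnerProductSpace ℂ H]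
    (e : ι → H) (f : H) : H :=
  ∑' i, (inner ℂ (e i) f : ℂ) • e i

end DOST

end

namespace DOST

/-! By Plancherel, the coefficients of `f` in the block `p` are `β^(-1/2)` times the Fourier
integrals of `g = conj Φ_p · 𝓕 f` at the frequencies `k / L`, where `L = β / ν`. Parseval for the
`L`-periodization of `g` turns the sum over `k` into `(1/ν) ∫_0^L |∑_j g(x + jL)|²` (`inner_system`,
`tsum_enorm_sq_integral_exp_mul`).

Expanding the square, the diagonal part is `(1/ν) ∫ |𝓕 f|² |Φ_p|²`. Summed over `p`, it lies between
`a/ν` and `b/ν` times `‖f‖²` by hypothesis. The off-diagonal part is at most `(1/ν) ∫ |𝓕 f|² |Φ_p|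
∑_{m ≠ 0} |Φ_p(· + mL)|` by the arithmetic-geometric mean inequality (`crossEnergy_mul_le`). It
remains to make `∑_p |Φ_p| ∑_{m ≠ 0} |Φ_p(· + mL)|` at most `a/2`.

The centres in a block spread over at most `μβ`, while the shift is `|m|β/ν`. For `2μν ≤ 1` any two
centres involved stay at least `|m|/(2ν)` apart. Half of the decay exponent pays `(2ν/|m|)^(N/2)`
for this distance; the other half, `N/2 > 1`, still sums over the lattice. The blocks are disjoint,
so the resulting `O(ν^(N/2))` is uniform in `α`. -/

/-! ### Fourier side of the atoms and their coefficients. -/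

theorem integral_fourier_smul_eq {f g : ℝ → ℂ} (hf : Integrable f) (hg : Integrable g) :
    ∫ ξ, 𝓕 f ξ • g ξ = ∫ x, f x • 𝓕 g x := by
  have := VectorFourier.integral_fourierIntegral_smul_eq_flip (μ := volume) (ν := volume)
    (L := innerₗ ℝ) Real.continuous_fourierChar continuous_inner hf hg
  rwa [flip_innerₗ] at this

theorem continuous_fourier {f : ℝ → ℂ} (hf : Integrable f) : Continuous (𝓕 f) :=
  VectorFourier.fourierIntegral_continuous Real.continuous_fourierChar
    (innerSL ℝ).continuous₂ hf

/-- On `L¹ ∩ L²` the `L²`-Fourier transform is given by the Fourier integral. -/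
theorem coeFn_fourier_toLp {f : ℝ → ℂ} (hf : Integrable f) (hf2 : MemLp f 2 volume) :
    ((𝓕 (hf2.toLp f) : Lp ℂ 2 (volume : Measure ℝ)) : ℝ → ℂ) =ᵐ[volume] 𝓕 f := by
  refine ae_eq_of_integral_contDiff_smul_eq
    ((Lp.memLp _).locallyIntegrable (by norm_num)) (continuous_fourier hf).locallyIntegrable ?_
  intro g hg hgs
  have hgs' : HasCompactSupport (Complex.ofRealCLM ∘ g) := hgs.comp_left rfl
  let G : SchwartzMap ℝ ℂ := hgs'.toSchwartzMap (by fun_prop)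
  have h1 := DFunLike.congr_fun (Lp.fourier_toTemperedDistribution_eq (hf2.toLp f)) G
  rw [TemperedDistribution.fourier_apply, Lp.toTemperedDistribution_apply,
    Lp.toTemperedDistribution_apply] at h1
  have hG : ∀ x, G x = (g x : ℂ) := fun x => rfl
  calc ∫ x, g x • ((𝓕 (hf2.toLp f) : Lp ℂ 2 (volume : Measure ℝ)) : ℝ → ℂ) x
      = ∫ x, G x • ((𝓕 (hf2.toLp f) : Lp ℂ 2 (volume : Measure ℝ)) : ℝ → ℂ) x := by
        simp [hG]
    _ = ∫ x, (𝓕 G) x • hf2.toLp f x := h1.symm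
    _ = ∫ x, f x • 𝓕 (G : ℝ → ℂ) x := by
        refine integral_congr_ae ?_
        filter_upwards [hf2.coeFn_toLp] with x hx
        rw [hx, smul_eq_mul, smul_eq_mul, mul_comm, SchwartzMap.fourier_coe]
    _ = ∫ x, 𝓕 f x • G x := (integral_fourier_smul_eq hf G.integrable).symm
    _ = _ := by simp [hG, mul_comm]

theorem memLp_fourier {f : ℝ → ℂ} (hf : Integrable f) (hf2 : MemLp f 2 volume) :
    MemLp (𝓕 f) 2 volume :=
  (memLp_congr_ae (coeFn_fourier_toLp hf hf2)).1 (Lp.memLp _)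

theorem integrable_modulated_translate {φ : ℝ → ℂ} (hφ : Integrable φ) (η c : ℝ) :
    Integrable (fun t : ℝ => Complex.exp (2 * Real.pi * Complex.I * ((η * (t - c) : ℝ) : ℂ)) *
      φ (t - c)) := by
  have h1 : Integrable (fun t : ℝ => φ (t - c)) := hφ.comp_sub_right c
  refine h1.bdd_mul (c := 1) (by fun_prop : Continuous _).aestronglyMeasurable ?_
  refine Filter.Eventually.of_forall fun t => ?_
  rw [mul_right_comm (2 * (Real.pi : ℂ)), ← Complex.ofReal_ofNat,
      ← Complex.ofReal_mul, ← Complex.ofReal_mul, Complex.norm_exp_ofReal_mul_I]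

theorem fourier_modulated_translate (φ : ℝ → ℂ) (η c ω : ℝ) :
    𝓕 (fun t : ℝ => Complex.exp (2 * Real.pi * Complex.I * ((η * (t - c) : ℝ) : ℂ)) *
      φ (t - c)) ω = Complex.exp (-(2 * Real.pi * Complex.I * ((c * ω : ℝ) : ℂ))) *
        𝓕 φ (ω - η) := by
  rw [Real.fourier_real_eq_integral_exp_smul, Real.fourier_real_eq_integral_exp_smul,
    ← integral_const_mul]
  rw [← integral_add_right_eq_self _ c]
  congr 1; ext t
  simp only [add_sub_cancel_right, smul_eq_mul, ← mul_assoc, ← Complex.exp_add]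
  congr 2
  push_cast; ring

theorem integrable_atomFun {φ : ℝ → ℂ} (hφ : Integrable φ) (μ ν α : ℝ) (p k : ℤ) :
    Integrable (atomFun φ μ ν α p k) := by
  unfold atomFun
  exact (integrable_finsetSum _ fun n _ => integrable_modulated_translate hφ _ _).const_mul _

theorem fourier_atomFun {φ : ℝ → ℂ} (hφ : Integrable φ) (μ ν α : ℝ) (p k : ℤ) (ω : ℝ) :
    𝓕 (atomFun φ μ ν α p k) ω = ((1 / Real.sqrt (beta α p : ℝ) : ℝ) : ℂ) *
      (Complex.exp (-(2 * Real.pi * Complex.I * ((k * ν / (beta α p : ℝ) * ω : ℝ) : ℂ))) *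
        Phi φ μ α p ω) := by
  have h := fun n : ℤ => fourier_modulated_translate φ (μ * n) (k * ν / (beta α p : ℝ)) ω
  unfold Phi
  rw [Finset.mul_sum, ← Finset.sum_congr rfl fun n _ => h n]
  simp only [Real.fourier_real_eq_integral_exp_smul]
  rw [← integral_finsetSum, ← integral_const_mul]
  · congr 1; ext t
    simp only [atomFun, smul_eq_mul, Finset.mul_sum]
    refine Finset.sum_congr rfl fun n _ => ?_
    ring
  · intro n _
    refine (integrable_modulated_translate hφ (μ * n) (k * ν / (beta α p : ℝ))).bdd_mul (c := 1)
      (by fun_prop : Continuous _).aestronglyMeasurable ?_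
    exact Filter.Eventually.of_forall fun t => (Complex.norm_exp_ofReal_mul_I _).le

theorem continuous_Phi {φ : ℝ → ℂ} (hφ : Integrable φ) (μ α : ℝ) (p : ℤ) :
    Continuous (Phi φ μ α p) := by
  unfold Phi
  exact continuous_finsetSum _ fun n _ => (continuous_fourier hφ).comp (by fun_prop)

theorem memLp_Phi {φ : ℝ → ℂ} (hφ : Integrable φ) (hφ2 : MemLp φ 2 volume) (μ α : ℝ) (p : ℤ) :
    MemLp (Phi φ μ α p) 2 volume := by
  unfold Phi
  exact memLp_finsetSum _ fun n _ => (memLp_fourier hφ hφ2).comp_measurePreserving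
    (measurePreserving_sub_right volume _)

/-- Plancherel's formula for the coefficients of `f` with respect to the system. -/
theorem inner_system {φ : ℝ → ℂ} (hφ : Integrable φ) (hφ2 : MemLp φ 2 volume) (μ ν α : ℝ)
    (p k : ℤ) (f : Lp ℂ 2 (volume : Measure ℝ)) :
    inner ℂ (system φ hφ2 μ ν α (p, k)) f = ((1 / Real.sqrt (beta α p : ℝ) : ℝ) : ℂ) *
      ∫ ω, Complex.exp (2 * Real.pi * Complex.I * ((k * ν / (beta α p : ℝ) * ω : ℝ) : ℂ)) *
        ((starRingEnd ℂ) (Phi φ μ α p ω) *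
          ((𝓕 f : Lp ℂ 2 (volume : Measure ℝ)) : ℝ → ℂ) ω) := by
  rw [← Lp.inner_fourier_eq, L2.inner_def, ← integral_const_mul]
  refine integral_congr_ae ?_
  filter_upwards [coeFn_fourier_toLp (integrable_atomFun hφ μ ν α p k)
    (memLp_atomFun hφ2 μ ν α p k)] with ω h
  simp only [system]
  rw [h, fourier_atomFun hφ, RCLike.inner_apply]
  simp only [map_mul, Complex.conj_ofReal, ← Complex.exp_conj, map_neg, Complex.conj_I, map_ofNat]
  rw [show -(2 * (Real.pi : ℂ) * -Complex.I * ((k * ν / (beta α p : ℝ) * ω : ℝ) : ℂ)) =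
    2 * Real.pi * Complex.I * ((k * ν / (beta α p : ℝ) * ω : ℝ) : ℂ) by ring]
  ring

/-! ### Periodization and Parseval. -/

/-- The equivalence of `ℤ` with the multiples of a positive real. -/
noncomputable def zmultiplesEquiv {L : ℝ} (hL : 0 < L) : ℤ ≃ AddSubgroup.zmultiples L :=
  Equiv.ofInjective (fun n : ℤ => n • L) (zsmul_left_strictMono hL).injective

theorem zmultiplesEquiv_vadd {L : ℝ} (hL : 0 < L) (j : ℤ) (x : ℝ) :
    zmultiplesEquiv hL j +ᵥ x = x + j * L := by
  have : ((zmultiplesEquiv hL j : AddSubgroup.zmultiples L) : ℝ) = j • L := rfl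
  rw [AddSubgroup.vadd_def, this, vadd_eq_add, zsmul_eq_mul, add_comm]

theorem tsum_lintegral_translate {L : ℝ} (hL : 0 < L) (f : ℝ → ENNReal) :
    ∑' j : ℤ, ∫⁻ x in Set.Ioc 0 L, f (x + j * L) = ∫⁻ x, f x := by
  have h := (isAddFundamentalDomain_Ioc hL 0).lintegral_eq_tsum'' f
  rw [h, ← (zmultiplesEquiv hL).tsum_eq, zero_add]
  simp only [zmultiplesEquiv_vadd]

theorem lintegral_periodize {L : ℝ} (hL : 0 < L) {f : ℝ → ENNReal} (hf : AEMeasurable f) :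
    ∫⁻ x in Set.Ioc 0 L, ∑' j : ℤ, f (x + j * L) = ∫⁻ x, f x := by
  rw [lintegral_tsum, tsum_lintegral_translate hL]
  intro j
  exact (hf.comp_quasiMeasurePreserving
    (measurePreserving_add_right volume _).quasiMeasurePreserving).restrict

theorem integral_periodize {L : ℝ} (hL : 0 < L) {g : ℝ → ℂ} (hg : Integrable g) :
    ∫ x in Set.Ioc 0 L, ∑' j : ℤ, g (x + j * L) = ∫ x, g x := by
  rw [integral_tsum]
  · have h := (isAddFundamentalDomain_Ioc hL 0).integral_eq_tsum'' g hg
    rw [h, ← (zmultiplesEquiv hL).tsum_eq, zero_add]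
    simp only [zmultiplesEquiv_vadd]
  · intro j
    exact (hg.comp_add_right (j * L)).1.restrict
  · rw [tsum_lintegral_translate hL (fun x => ‖g x‖ₑ)]
    exact hg.2.ne

theorem ae_summable_translate {L : ℝ} (hL : 0 < L) {g : ℝ → ℂ} (hg : Integrable g) :
    ∀ᵐ x ∂(volume.restrict (Set.Ioc 0 L)), ∑' j : ℤ, ‖g (x + j * L)‖ₑ < ⊤ := by
  refine ae_lt_top' ?_ ?_
  · refine AEMeasurable.tsum fun j => ?_
    exact (hg.comp_add_right (j * L)).1.restrict.enorm
  · rw [lintegral_periodize hL hg.1.enorm]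
    exact hg.2.ne

/-- Parseval's identity for the periodization of an integrable function. -/
theorem tsum_enorm_sq_integral_exp_mul {L : ℝ} (hL : 0 < L) {g : ℝ → ℂ} (hg : Integrable g)
    (hP : MemLp (fun x => ∑' j : ℤ, g (x + j * L)) 2 (volume.restrict (Set.Ioc 0 L))) :
    ∑' k : ℤ, ‖∫ x, Complex.exp (2 * Real.pi * Complex.I * ((k / L * x : ℝ) : ℂ)) * g x‖ₑ ^ 2 =
      ENNReal.ofReal L * ∫⁻ x in Set.Ioc 0 L, ‖∑' j : ℤ, g (x + j * L)‖ₑ ^ 2 := by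
  set P : ℝ → ℂ := fun x => ∑' j : ℤ, g (x + j * L) with hPdef
  -- The index is `-k` because Fourier coefficients carry the opposite sign in the exponent; the
  -- factor `L` undoes their normalization.
  have hcoeff : ∀ k : ℤ,
      ∫ x, Complex.exp (2 * Real.pi * Complex.I * ((k / L * x : ℝ) : ℂ)) * g x =
        L * fourierCoeffOn hL P (-k) := by
    intro k
    have hint : Integrable (fun x : ℝ =>
        Complex.exp (2 * Real.pi * Complex.I * ((k / L * x : ℝ) : ℂ)) * g x) := by
      refine hg.bdd_mul (c := 1) (by fun_prop : Continuous _).aestronglyMeasurable ?_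
      refine Filter.Eventually.of_forall fun t => ?_
      rw [mul_right_comm (2 * (Real.pi : ℂ)), ← Complex.ofReal_ofNat,
        ← Complex.ofReal_mul, ← Complex.ofReal_mul, Complex.norm_exp_ofReal_mul_I]
    rw [← integral_periodize hL hint, fourierCoeffOn_eq_integral,
      intervalIntegral.integral_of_le hL.le, sub_zero, neg_neg, Complex.real_smul]
    have hL' : (L : ℂ) ≠ 0 := by exact_mod_cast hL.ne'
    push_cast
    rw [← mul_assoc, mul_one_div_cancel hL', one_mul]
    congr 1; ext x
    rw [hPdef, smul_eq_mul, ← tsum_mul_left]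
    refine tsum_congr fun j => ?_
    rw [fourier_coe_apply]
    congr 1
    rw [Complex.exp_eq_exp_iff_exists_int]
    refine ⟨k * j, ?_⟩
    push_cast
    field_simp
  have hsum := hasSum_sq_fourierCoeffOn hL hP
  have hneg := (Equiv.neg ℤ).hasSum_iff.2 hsum
  have h2 := hneg.mul_left (L ^ 2)
  have hen : ∀ k : ℤ, ‖∫ x, Complex.exp (2 * Real.pi * Complex.I * ((k / L * x : ℝ) : ℂ)) *
      g x‖ₑ ^ 2 = ENNReal.ofReal (L ^ 2 * ‖fourierCoeffOn hL P (-k)‖ ^ 2) := by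
    intro k
    rw [hcoeff, ← ofReal_norm, ← ENNReal.ofReal_pow (norm_nonneg _), norm_mul, mul_pow,
      Complex.norm_real, Real.norm_eq_abs, sq_abs]
  simp_rw [hen]
  simp only [Function.comp_def, Equiv.neg_apply] at h2
  rw [← ENNReal.ofReal_tsum_of_nonneg (fun k => by positivity) h2.summable]
  rw [h2.tsum_eq, sub_zero, intervalIntegral.integral_of_le hL.le, smul_eq_mul, ← mul_assoc, pow_two L,
    mul_assoc L L, mul_inv_cancel₀ hL.ne', mul_one, ENNReal.ofReal_mul hL.le]
  congr 1
  rw [ofReal_integral_eq_lintegral_ofReal hP.norm.integrable_sq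
    (Filter.Eventually.of_forall fun x => by positivity)]
  refine lintegral_congr fun x => ?_
  rw [ENNReal.ofReal_pow (norm_nonneg _), ofReal_norm]

/-! ### Diagonal and off-diagonal parts of the periodized energy. -/

/-- The off-diagonal part of the double sum of `‖x j‖ ‖x l‖`. -/
noncomputable def offDiag (x : ℤ → ENNReal) : ENNReal :=
  ∑' j : ℤ, x j * ∑' m : ℤ, if m = 0 then 0 else x (j + m)

theorem tsum_eq_add_offDiag (x : ℤ → ENNReal) (j : ℤ) :
    ∑' l : ℤ, x l = x j + ∑' m : ℤ, if m = 0 then 0 else x (j + m) := by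
  rw [← (Equiv.addLeft j).tsum_eq, ENNReal.tsum_eq_add_tsum_ite 0]
  simp only [Equiv.coe_addLeft, add_zero]
  refine congrArg _ (tsum_congr fun m => ?_)
  split_ifs <;> rfl

theorem sq_tsum_eq (x : ℤ → ENNReal) :
    (∑' j, x j) ^ 2 = ∑' j, x j ^ 2 + offDiag x := by
  rw [offDiag, ← ENNReal.tsum_add, pow_two, ← ENNReal.tsum_mul_right]
  refine tsum_congr fun j => ?_
  rw [tsum_eq_add_offDiag x j, mul_add, pow_two]

theorem enorm_tsum_sq_le (x : ℤ → ℂ) :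
    ‖∑' j, x j‖ₑ ^ 2 ≤ ∑' j, ‖x j‖ₑ ^ 2 + offDiag (fun j => ‖x j‖ₑ) := by
  rw [← sq_tsum_eq]
  gcongr
  exact enorm_tsum_le_tsum_enorm

/-- With `s = ∑ x j`, one has `∑ |x j|² = |s|² - ∑ x j · conj (s - x j)`, and `s - x j` is the sum
of the other terms. Absolute convergence is needed here, since a divergent `tsum` would make `s`
zero. -/
theorem tsum_enorm_sq_le {x : ℤ → ℂ} (hx : ∑' j, ‖x j‖ₑ < ⊤) :
    ∑' j, ‖x j‖ₑ ^ 2 ≤ ‖∑' j, x j‖ₑ ^ 2 + offDiag (fun j => ‖x j‖ₑ) := by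
  have hs : Summable fun j => ‖x j‖ := by
    have := ENNReal.summable_toReal hx.ne
    simpa using this
  have hxs : Summable x := hs.of_norm
  have hlt : ∀ j, ∑' m : ℤ, (if m = 0 then 0 else x (j + m)) = (∑' l, x l) - x j := by
    intro j
    rw [← (Equiv.addLeft j).tsum_eq x,
      Summable.tsum_eq_add_tsum_ite (f := fun m => x (Equiv.addLeft j m))
        ((Equiv.addLeft j).summable_iff.2 hxs) 0]
    simp only [Equiv.coe_addLeft, add_zero, add_sub_cancel_left]
  set s := ∑' l, x l
  have hb : ∀ j, ‖s - x j‖ₑ ≤ ∑' m : ℤ, if m = 0 then 0 else ‖x (j + m)‖ₑ := by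
    intro j
    rw [← hlt j]
    refine enorm_tsum_le_tsum_enorm.trans (le_of_eq (tsum_congr fun m => ?_))
    split_ifs <;> simp
  have hsq : ∀ j, ‖x j‖ ^ 2 ≤ ‖x j‖ * ∑' l, ‖x l‖ := by
    intro j
    rw [pow_two]
    gcongr
    exact hs.le_tsum j fun _ _ => norm_nonneg _
  have hsqs : Summable fun j => ‖x j‖ ^ 2 :=
    Summable.of_nonneg_of_le (fun j => by positivity) hsq (hs.mul_right _)
  have hid : ((∑' j, ‖x j‖ ^ 2 : ℝ) : ℂ) = s * (starRingEnd ℂ) s -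
      ∑' j, x j * (starRingEnd ℂ) (s - x j) := by
    have h1 : Summable fun j => x j * (starRingEnd ℂ) s := hxs.mul_right _
    have h2 : Summable fun j => ((‖x j‖ ^ 2 : ℝ) : ℂ) := Complex.summable_ofReal.2 hsqs
    have h3 : ∀ j, x j * (starRingEnd ℂ) (s - x j) =
        x j * (starRingEnd ℂ) s - ((‖x j‖ ^ 2 : ℝ) : ℂ) := by
      intro j
      rw [map_sub, mul_sub, Complex.mul_conj']
      push_cast; ring
    simp_rw [h3]
    rw [h1.tsum_sub h2, tsum_mul_right, Complex.ofReal_tsum]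
    ring
  have hen : ∑' j, ‖x j‖ₑ ^ 2 = ‖((∑' j, ‖x j‖ ^ 2 : ℝ) : ℂ)‖ₑ := by
    rw [← ofReal_norm, Complex.norm_real, Real.norm_of_nonneg (tsum_nonneg fun j => by positivity),
      ENNReal.ofReal_tsum_of_nonneg (fun j => by positivity) hsqs]
    refine tsum_congr fun j => ?_
    rw [ENNReal.ofReal_pow (norm_nonneg _), ofReal_norm]
  rw [hen, hid]
  refine (enorm_sub_le).trans ?_
  gcongr
  · rw [enorm_mul, RCLike.enorm_conj, pow_two]
  · refine enorm_tsum_le_tsum_enorm.trans (ENNReal.tsum_le_tsum fun j => ?_)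
    rw [enorm_mul, RCLike.enorm_conj]
    gcongr
    exact hb j

/-- The correlation of `g` with its nontrivial translates by multiples of `L`. -/
noncomputable def crossEnergy (L : ℝ) (g : ℝ → ℂ) : ENNReal :=
  ∫⁻ x, ‖g x‖ₑ * ∑' m : ℤ, if m = 0 then 0 else ‖g (x + m * L)‖ₑ

theorem aemeasurable_enorm_translate {g : ℝ → ℂ} (hg : AEStronglyMeasurable g volume) (c : ℝ) :
    AEMeasurable (fun x => ‖g (x + c)‖ₑ) :=
  (hg.comp_quasiMeasurePreserving
    (measurePreserving_add_right volume c).quasiMeasurePreserving).enorm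

theorem aemeasurable_tsum_translate {g : ℝ → ℂ} (hg : AEStronglyMeasurable g volume) (L : ℝ) :
    AEMeasurable (fun x => ∑' m : ℤ, if m = 0 then 0 else ‖g (x + m * L)‖ₑ) := by
  refine AEMeasurable.tsum fun m => ?_
  by_cases h : m = 0
  · simp [h]
  · simpa [h] using aemeasurable_enorm_translate hg _

theorem lintegral_offDiag {L : ℝ} (hL : 0 < L) {g : ℝ → ℂ} (hg : AEStronglyMeasurable g volume) :
    ∫⁻ x in Set.Ioc 0 L, offDiag (fun j => ‖g (x + j * L)‖ₑ) = crossEnergy L g := by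
  unfold crossEnergy
  have h := lintegral_periodize hL (hg.enorm.mul (aemeasurable_tsum_translate hg L))
  simp only [Pi.mul_apply] at h
  rw [← h]
  unfold offDiag
  refine lintegral_congr fun x => tsum_congr fun j => ?_
  simp only [Int.cast_add, add_mul, add_assoc]

theorem aestronglyMeasurable_periodize {g : ℝ → ℂ} (hg : AEStronglyMeasurable g volume) (L : ℝ) :
    AEStronglyMeasurable (fun x => ∑' j : ℤ, g (x + j * L)) volume := by
  refine AEMeasurable.aestronglyMeasurable (AEMeasurable.tsum fun j => ?_)
  exact (hg.comp_quasiMeasurePreserving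
    (measurePreserving_add_right volume _).quasiMeasurePreserving).aemeasurable

theorem lintegral_enorm_periodize_sq_le {L : ℝ} (hL : 0 < L) {g : ℝ → ℂ}
    (hg : AEStronglyMeasurable g volume) :
    ∫⁻ x in Set.Ioc 0 L, ‖∑' j : ℤ, g (x + j * L)‖ₑ ^ 2 ≤
      (∫⁻ x, ‖g x‖ₑ ^ 2) + crossEnergy L g := by
  have h2 : AEMeasurable (fun x => ‖g x‖ₑ ^ 2) := hg.enorm.pow_const 2
  rw [← lintegral_offDiag hL hg,
    ← lintegral_periodize hL h2, ← lintegral_add_left']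
  · exact lintegral_mono fun x => enorm_tsum_sq_le _
  · exact AEMeasurable.tsum fun j =>
      ((aemeasurable_enorm_translate hg _).pow_const 2).restrict

theorem lintegral_enorm_sq_le {L : ℝ} (hL : 0 < L) {g : ℝ → ℂ} (hg : Integrable g) :
    ∫⁻ x, ‖g x‖ₑ ^ 2 ≤
      (∫⁻ x in Set.Ioc 0 L, ‖∑' j : ℤ, g (x + j * L)‖ₑ ^ 2) + crossEnergy L g := by
  have h2 : AEMeasurable (fun x => ‖g x‖ₑ ^ 2) := hg.1.enorm.pow_const 2
  rw [← lintegral_offDiag hL hg.1, ← lintegral_periodize hL h2, ← lintegral_add_left']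
  · refine lintegral_mono_ae ?_
    filter_upwards [ae_summable_translate hL hg] with x hx
    exact tsum_enorm_sq_le hx
  · exact (aestronglyMeasurable_periodize hg.1 L).restrict.enorm.pow_const 2

/-- Supplies the square integrability that Parseval requires: over one period the energy is at most
the full energy of `g` plus its cross energy. -/
theorem memLp_periodize {L : ℝ} (hL : 0 < L) {g : ℝ → ℂ}
    (hg2 : MemLp g 2 volume) (hE : crossEnergy L g ≠ ⊤) :
    MemLp (fun x => ∑' j : ℤ, g (x + j * L)) 2 (volume.restrict (Set.Ioc 0 L)) := by
  refine ⟨(aestronglyMeasurable_periodize hg2.1 L).restrict, ?_⟩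
  have h := hg2.2
  rw [eLpNorm_lt_top_iff_lintegral_rpow_enorm_lt_top (by norm_num) (by norm_num)] at h ⊢
  simp only [ENNReal.toReal_ofNat, ENNReal.rpow_ofNat] at h ⊢
  exact (lintegral_enorm_periodize_sq_le hL hg2.1).trans_lt (ENNReal.add_lt_top.2 ⟨h, hE.lt_top⟩)

theorem tsum_enorm_sq_integral_exp_mul_bounds {L : ℝ} (hL : 0 < L) {g : ℝ → ℂ} (hg : Integrable g)
    (hg2 : MemLp g 2 volume) (hE : crossEnergy L g ≠ ⊤) :
    ∑' k : ℤ, ‖∫ x, Complex.exp (2 * Real.pi * Complex.I * ((k / L * x : ℝ) : ℂ)) * g x‖ₑ ^ 2 ≤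
      ENNReal.ofReal L * ((∫⁻ x, ‖g x‖ₑ ^ 2) + crossEnergy L g) ∧
    ENNReal.ofReal L * ∫⁻ x, ‖g x‖ₑ ^ 2 ≤
      ∑' k : ℤ, ‖∫ x, Complex.exp (2 * Real.pi * Complex.I * ((k / L * x : ℝ) : ℂ)) * g x‖ₑ ^ 2 +
        ENNReal.ofReal L * crossEnergy L g := by
  rw [tsum_enorm_sq_integral_exp_mul hL hg (memLp_periodize hL hg2 hE), ← mul_add]
  exact ⟨by gcongr; exact lintegral_enorm_periodize_sq_le hL hg.1,
    by gcongr; exact lintegral_enorm_sq_le hL hg⟩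

/-! ### Combinatorics of the frequency blocks. -/

theorem rightEnd_eq (α : ℝ) (p : ℕ) : rightEnd α p = leftEnd α p + width α p := by
  cases p <;> rfl

theorem rightEnd_pos (α : ℝ) (p : ℕ) : 1 ≤ rightEnd α p := by
  induction p with
  | zero => exact le_rfl
  | succ p ih => exact ih.trans (Nat.le_add_right _ _)

theorem one_le_width {α : ℝ} (hα : 0 ≤ α) (p : ℕ) : 1 ≤ width α p := by
  cases p with
  | zero => exact le_rfl
  | succ p =>
    refine Nat.le_floor ?_
    rw [Nat.cast_one]
    exact Real.one_le_rpow (by exact_mod_cast rightEnd_pos α p) hα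

theorem one_le_beta {α : ℝ} (hα : 0 ≤ α) (p : ℤ) : 1 ≤ beta α p := one_le_width hα _

theorem monotone_leftEnd (α : ℝ) : Monotone (leftEnd α) := by
  refine monotone_nat_of_le_succ fun p => ?_
  change leftEnd α p ≤ rightEnd α p
  rw [rightEnd_eq]
  exact Nat.le_add_right _ _

theorem one_le_leftEnd (α : ℝ) {p : ℕ} (hp : p ≠ 0) : 1 ≤ leftEnd α p := by
  cases p with
  | zero => exact absurd rfl hp
  | succ p => exact rightEnd_pos α p

theorem natAbs_mem_of_mem_block {α : ℝ} {p n : ℤ} (h : n ∈ block α p) :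
    n.natAbs ∈ Set.Ico (leftEnd α p.natAbs) (leftEnd α (p.natAbs + 1)) := by
  change _ ∈ Set.Ico _ (rightEnd α p.natAbs)
  unfold block at h
  split_ifs at h with hp
  · rw [Finset.mem_Ico] at h
    rw [Set.mem_Ico]; omega
  · rw [Finset.mem_Ioc] at h
    rw [Set.mem_Ico]; omega

theorem nonneg_iff_of_mem_block {α : ℝ} {p n : ℤ} (h : n ∈ block α p) : 0 ≤ n ↔ 0 ≤ p := by
  unfold block at h
  split_ifs at h with hp
  · rw [Finset.mem_Ico] at h
    exact ⟨fun _ => hp, fun _ => by omega⟩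
  · rw [Finset.mem_Ioc] at h
    have := one_le_leftEnd α (p := p.natAbs) (by omega)
    exact ⟨fun _ => by omega, fun h' => absurd h' hp⟩

theorem eq_of_mem_block {α : ℝ} {p q n : ℤ} (hp : n ∈ block α p) (hq : n ∈ block α q) : p = q := by
  have h1 : p.natAbs = q.natAbs := by
    by_contra hne
    exact Set.disjoint_left.1 ((monotone_leftEnd α).pairwise_disjoint_on_Ico_succ hne)
      (natAbs_mem_of_mem_block hp) (natAbs_mem_of_mem_block hq)
  have h2 := nonneg_iff_of_mem_block hp
  have h3 := nonneg_iff_of_mem_block hq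
  omega

theorem abs_sub_le_beta {α : ℝ} {p n m : ℤ} (hn : n ∈ block α p) (hm : m ∈ block α p) :
    |m - n| ≤ beta α p := by
  have := rightEnd_eq α p.natAbs
  unfold beta
  unfold block at hn hm
  split_ifs at hn hm
  · rw [Finset.mem_Ico] at hn hm
    rw [abs_le]; omega
  · rw [Finset.mem_Ioc] at hn hm
    rw [abs_le]; omega

/-- Each integer lies in at most one block. This is what removes `α` from the constants; that the
blocks cover `ℤ` is not needed. -/
theorem tsum_sum_block_le (α : ℝ) (h : ℤ → ENNReal) :
    ∑' p : ℤ, ∑ n ∈ block α p, h n ≤ ∑' n, h n := by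
  have h1 : ∀ p, ∑ n ∈ block α p, h n = ∑' n, if n ∈ block α p then h n else 0 := by
    intro p
    rw [tsum_eq_sum (s := block α p) (fun n hn => if_neg hn)]
    exact Finset.sum_congr rfl fun n hn => (if_pos hn).symm
  simp_rw [h1]
  rw [ENNReal.tsum_comm]
  refine ENNReal.tsum_le_tsum fun n => ?_
  by_cases hn : ∃ p, n ∈ block α p
  · obtain ⟨p, hp⟩ := hn
    rw [tsum_eq_single p fun q hq => if_neg fun h' => hq (eq_of_mem_block h' hp), if_pos hp]
  · push Not at hn
    simp [hn]

/-! ### Polynomial decay and almost-orthogonality. -/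

/-- The polynomial weight `(1 + |x|) ^ (-s)`. -/
noncomputable def weight (s x : ℝ) : ENNReal := ENNReal.ofReal ((1 + |x|) ^ (-s))

/-- Recentring the index at `⌊ω / μ⌋` gives `1 + |n - ⌊ω / μ⌋| ≤ (2 + 1 / μ) (1 + |ω - μ n|)`, so
one convergent series dominates for all `ω`. -/
theorem exists_tsum_weight_le {s μ : ℝ} (hs : 1 < s) (hμ : 0 < μ) :
    ∃ K : ENNReal, K ≠ ⊤ ∧ ∀ ω : ℝ, ∑' n : ℤ, weight s (ω - μ * n) ≤ K := by
  set M : ℝ := 2 + 1 / μ with hM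
  have hM0 : 0 < M := by positivity
  refine ⟨∑' m : ℤ, ENNReal.ofReal (((1 + |(m : ℝ)|) / M) ^ (-s)), ?_, fun ω => ?_⟩
  · have hsum : Summable fun m : ℤ => ((1 + |(m : ℝ)|) / M) ^ (-s) := by
      -- The offset `1 / 2` keeps the comparison term at `m = 0` from being a division by zero.
      have h1 := ((Real.summable_one_div_int_add_rpow (1 / 2) s).2 hs).div_const (M ^ (-s))
      refine Summable.of_nonneg_of_le (fun m => by positivity) (fun m => ?_) h1
      rw [Real.div_rpow (by positivity) hM0.le, one_div, ← Real.rpow_neg (abs_nonneg _)]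
      gcongr ?_ / _
      have hne : (m : ℝ) + 1 / 2 ≠ 0 := by
        intro h
        have : (2 * m + 1 : ℝ) = 0 := by linarith
        norm_cast at this
        omega
      refine Real.rpow_le_rpow_of_nonpos (abs_pos.2 hne) ?_ (by linarith)
      refine (abs_add_le _ _).trans ?_
      rw [abs_of_pos (by norm_num : (0 : ℝ) < 1 / 2)]
      linarith
    rw [← ENNReal.ofReal_tsum_of_nonneg (fun m => by positivity) hsum]
    exact ENNReal.ofReal_ne_top
  · rw [← (Equiv.subRight ⌊ω / μ⌋).tsum_eq
      (fun m : ℤ => ENNReal.ofReal (((1 + |(m : ℝ)|) / M) ^ (-s)))]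
    refine ENNReal.tsum_le_tsum fun n => ENNReal.ofReal_le_ofReal ?_
    refine Real.rpow_le_rpow_of_nonpos (by positivity) ?_ (by linarith)
    rw [div_le_iff₀ hM0, Equiv.subRight_apply, Int.cast_sub]
    have h1 : |(n : ℝ) - ⌊ω / μ⌋| ≤ |ω - μ * n| / μ + 1 := by
      have h2 : |ω - μ * n| / μ = |ω / μ - n| := by
        rw [← abs_of_pos hμ, ← abs_div, abs_of_pos hμ]
        congr 1
        field_simp
      rw [h2]
      have h3 := Int.floor_le (ω / μ)
      have h4 := (Int.lt_floor_add_one (ω / μ)).le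
      calc |(n : ℝ) - ⌊ω / μ⌋| = |-(ω / μ - n) + (ω / μ - ⌊ω / μ⌋)| := by congr 1; ring
        _ ≤ |-(ω / μ - n)| + |ω / μ - ⌊ω / μ⌋| := abs_add_le _ _
        _ ≤ _ := by
          rw [abs_neg]
          gcongr
          rw [abs_le]; constructor <;> linarith
    have h5 : 0 ≤ |ω - μ * n| := abs_nonneg _
    have h6 : 0 < 1 / μ := by positivity
    calc 1 + |(n : ℝ) - ⌊ω / μ⌋| ≤ 2 + |ω - μ * n| * (1 / μ) := by
          rw [mul_one_div]; linarith
      _ ≤ _ := by rw [hM]; nlinarith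

/-- Since `(1 + |x|) (1 + |y|) ≥ |y - x| ≥ d`, half of the exponent can be traded for a power of
`d`. -/
theorem weight_mul_weight_le {s x y d : ℝ} (hs : 0 ≤ s) (hd : 0 < d) (h : d ≤ |y - x|) :
    weight (2 * s) x * weight (2 * s) y ≤ ENNReal.ofReal (d ^ (-s)) * (weight s x * weight s y) := by
  unfold weight
  have hx : 0 < 1 + |x| := by positivity
  have hy : 0 < 1 + |y| := by positivity
  rw [← ENNReal.ofReal_mul (by positivity), ← ENNReal.ofReal_mul (by positivity),
    ← ENNReal.ofReal_mul (by positivity)]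
  refine ENNReal.ofReal_le_ofReal ?_
  rw [← Real.mul_rpow hx.le hy.le, ← Real.mul_rpow hx.le hy.le,
    show -(2 * s) = -s + -s by ring, Real.rpow_add (by positivity)]
  gcongr ?_ * _
  refine Real.rpow_le_rpow_of_nonpos hd (h.trans ?_) (by linarith)
  have := abs_sub y x
  nlinarith [abs_nonneg x, abs_nonneg y]

/-- Almost-orthogonality of the translates of `Φ_p`, uniformly in `α` and `ω`. -/
theorem exists_tsum_Phi_mul_translate_le {φ : ℝ → ℂ} {N C μ : ℝ} (hN : 2 < N)
    (hdecay : ∀ ω : ℝ, ‖𝓕 φ ω‖ ≤ C / (1 + |ω|) ^ N) (hμ : 0 < μ) :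
    ∃ D : ℝ, 0 ≤ D ∧ ∀ α : ℝ, 0 ≤ α → ∀ ν : ℝ, 0 < ν → 2 * μ * ν ≤ 1 → ∀ ω : ℝ,
      ∑' p : ℤ, ‖Phi φ μ α p ω‖ₑ *
        (∑' m : ℤ, if m = 0 then 0 else ‖Phi φ μ α p (ω + m * (beta α p / ν))‖ₑ) ≤
      ENNReal.ofReal (D * (2 * ν) ^ (N / 2)) := by
  set s := N / 2 with hs
  have hs1 : 1 < s := by rw [hs]; linarith
  have hN' : N = 2 * s := by rw [hs]; ring
  obtain ⟨K, hK, hKle⟩ := exists_tsum_weight_le hs1 hμ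
  have hZ := Real.summable_abs_int_rpow hs1
  set Z : ENNReal := ∑' m : ℤ, ENNReal.ofReal (|(m : ℝ)| ^ (-s)) with hZdef
  have hZtop : Z ≠ ⊤ := by
    rw [hZdef, ← ENNReal.ofReal_tsum_of_nonneg (fun m => by positivity) hZ]
    exact ENNReal.ofReal_ne_top
  set c := ENNReal.ofReal C with hc
  -- `c²` comes from the two decay bounds and `Z` from the sum over shifts. One `K` bounds the
  -- translated block, the other all untranslated blocks together.
  refine ⟨(c ^ 2 * Z * K ^ 2).toReal, ENNReal.toReal_nonneg, fun α hα ν hν hμν ω => ?_⟩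
  have hPhi : ∀ p x, ‖Phi φ μ α p x‖ₑ ≤ c * ∑ n ∈ block α p, weight N (x - μ * n) := by
    intro p x
    unfold Phi
    refine (enorm_sum_le _ _).trans ?_
    rw [Finset.mul_sum]
    refine Finset.sum_le_sum fun n _ => ?_
    have h0 : 0 ≤ C := by
      have := (norm_nonneg _).trans (hdecay 0)
      simpa using this
    rw [weight, hc, ← ENNReal.ofReal_mul h0, ← ofReal_norm]
    refine ENNReal.ofReal_le_ofReal ((hdecay _).trans_eq ?_)
    rw [Real.rpow_neg (by positivity), div_eq_mul_inv]
  have hterm : ∀ p m : ℤ, m ≠ 0 →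
      ‖Phi φ μ α p ω‖ₑ * ‖Phi φ μ α p (ω + m * (beta α p / ν))‖ₑ ≤
        c ^ 2 * ENNReal.ofReal ((2 * ν) ^ s) * K * ENNReal.ofReal (|(m : ℝ)| ^ (-s)) *
          ∑ n ∈ block α p, weight s (ω - μ * n) := by
    intro p m hm
    have hβ : (1 : ℝ) ≤ beta α p := by exact_mod_cast one_le_beta hα p
    have hm1 : (1 : ℝ) ≤ |(m : ℝ)| := by
      have := Int.one_le_abs hm
      exact_mod_cast this
    have hd : 0 < |(m : ℝ)| / (2 * ν) := by positivity
    have hpair : ∀ n ∈ block α p, ∀ n' ∈ block α p,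
        weight N (ω - μ * n) * weight N (ω + m * (beta α p / ν) - μ * n') ≤
          ENNReal.ofReal ((|(m : ℝ)| / (2 * ν)) ^ (-s)) *
            (weight s (ω - μ * n) * weight s (ω + m * (beta α p / ν) - μ * n')) := by
      intro n hn n' hn'
      rw [hN']
      refine weight_mul_weight_le (by linarith) hd ?_
      have h1 : |((n' : ℝ) - n)| ≤ beta α p := by
        have := abs_sub_le_beta hn hn'
        exact_mod_cast this
      have h2 : ω + m * (beta α p / ν) - μ * n' - (ω - μ * n) =
        m * (beta α p / ν) - μ * (n' - n) := by ring
      rw [h2]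
      refine le_trans ?_ (abs_sub_abs_le_abs_sub _ _)
      rw [abs_mul, abs_mul, abs_of_pos hμ, abs_of_pos (by positivity : 0 < (beta α p : ℝ) / ν)]
      -- As `2μν ≤ 1 ≤ |m|`, the spread of the block is at most half of the shift; the other half is
      -- at least `|m| / (2ν)` because `β ≥ 1`.
      have h3 : μ * |((n' : ℝ) - n)| ≤ |(m : ℝ)| / (2 * ν) * beta α p := by
        have : μ ≤ |(m : ℝ)| / (2 * ν) := by
          rw [le_div_iff₀ (by positivity)]
          linarith
        gcongr
      have h4 : |(m : ℝ)| * (beta α p / ν) = 2 * (|(m : ℝ)| / (2 * ν) * beta α p) := by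
        field_simp
      have h5 : |(m : ℝ)| / (2 * ν) ≤ |(m : ℝ)| / (2 * ν) * beta α p :=
        le_mul_of_one_le_right hd.le hβ
      linarith
    have hd' : ENNReal.ofReal ((|(m : ℝ)| / (2 * ν)) ^ (-s)) =
        ENNReal.ofReal ((2 * ν) ^ s) * ENNReal.ofReal (|(m : ℝ)| ^ (-s)) := by
      rw [← ENNReal.ofReal_mul (by positivity), Real.div_rpow (by positivity) (by positivity),
        Real.rpow_neg (by positivity : 0 ≤ 2 * ν), div_inv_eq_mul, mul_comm]
    calc _ ≤ (c * ∑ n ∈ block α p, weight N (ω - μ * n)) *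
          (c * ∑ n ∈ block α p, weight N (ω + m * (beta α p / ν) - μ * n)) := by
            gcongr <;> exact hPhi _ _
      _ = c ^ 2 * ∑ n ∈ block α p, ∑ n' ∈ block α p,
          weight N (ω - μ * n) * weight N (ω + m * (beta α p / ν) - μ * n') := by
            rw [← Finset.sum_mul_sum]; ring
      _ ≤ c ^ 2 * ∑ n ∈ block α p, ∑ n' ∈ block α p,
          ENNReal.ofReal ((|(m : ℝ)| / (2 * ν)) ^ (-s)) *
            (weight s (ω - μ * n) * weight s (ω + m * (beta α p / ν) - μ * n')) := by
            gcongr c ^ 2 * ?_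
            exact Finset.sum_le_sum fun n hn => Finset.sum_le_sum fun n' hn' => hpair n hn n' hn'
      _ = c ^ 2 * (ENNReal.ofReal ((|(m : ℝ)| / (2 * ν)) ^ (-s)) *
          ((∑ n ∈ block α p, weight s (ω - μ * n)) *
            ∑ n' ∈ block α p, weight s (ω + m * (beta α p / ν) - μ * n'))) := by
            rw [Finset.sum_mul_sum, Finset.mul_sum]
            simp_rw [Finset.mul_sum]
      _ ≤ c ^ 2 * (ENNReal.ofReal ((|(m : ℝ)| / (2 * ν)) ^ (-s)) *
          ((∑ n ∈ block α p, weight s (ω - μ * n)) * K)) := by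
            gcongr
            exact (ENNReal.sum_le_tsum _).trans (hKle _)
      _ = _ := by rw [hd']; ring
  calc _ ≤ ∑' p : ℤ, ∑' m : ℤ, c ^ 2 * ENNReal.ofReal ((2 * ν) ^ s) * K *
        ENNReal.ofReal (|(m : ℝ)| ^ (-s)) * ∑ n ∈ block α p, weight s (ω - μ * n) := by
          refine ENNReal.tsum_le_tsum fun p => ?_
          rw [← ENNReal.tsum_mul_left]
          refine ENNReal.tsum_le_tsum fun m => ?_
          split_ifs with hm
          · simp
          · exact hterm p m hm
    _ = c ^ 2 * ENNReal.ofReal ((2 * ν) ^ s) * K * Z *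
        ∑' p : ℤ, ∑ n ∈ block α p, weight s (ω - μ * n) := by
          simp_rw [ENNReal.tsum_mul_right, ENNReal.tsum_mul_left, hZdef]
    _ ≤ c ^ 2 * ENNReal.ofReal ((2 * ν) ^ s) * K * Z * K := by
          gcongr
          exact (tsum_sum_block_le α _).trans (hKle ω)
    _ = _ := by
          rw [ENNReal.ofReal_mul ENNReal.toReal_nonneg, ENNReal.ofReal_toReal]
          · ring
          · exact ENNReal.mul_ne_top (ENNReal.mul_ne_top (by simp [hc]) hZtop) (by simp [hK])

/-! ### Frame operators in an abstract space. -/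

section FrameOperator

variable {ι H : Type*} [NormedAddCommGroup H] [InnerProductSpace ℂ H]

/-- Pair `y = ∑ c i • e i` with itself, apply Cauchy–Schwarz and the upper frame bound at `y`, then
cancel `‖y‖²`. -/
theorem IsFrame.norm_sum_smul_sq_le {e : ι → H} {A B : ℝ} (he : IsFrame e A B) (s : Finset ι)
    (c : ι → ℂ) : ‖∑ i ∈ s, c i • e i‖ ^ 2 ≤ B * ∑ i ∈ s, ‖c i‖ ^ 2 := by
  set y := ∑ i ∈ s, c i • e i with hy
  obtain ⟨hsum, -, hB⟩ := he.2.2 y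
  have h1 : ‖y‖ ^ 2 ≤ ∑ i ∈ s, ‖c i‖ * ‖inner ℂ (e i) y‖ := by
    have h0 : ‖y‖ ^ 2 = ‖(inner ℂ y y : ℂ)‖ := by simp [inner_self_eq_norm_sq_to_K]
    rw [h0]
    nth_rewrite 1 [hy]
    rw [sum_inner]
    refine (norm_sum_le _ _).trans (le_of_eq (Finset.sum_congr rfl fun i _ => ?_))
    rw [inner_smul_left, norm_mul, RCLike.norm_conj]
  have h2 := Finset.sum_mul_sq_le_sq_mul_sq s (fun i => ‖c i‖) (fun i => ‖inner ℂ (e i) y‖)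
  have h3 : ∑ i ∈ s, ‖inner ℂ (e i) y‖ ^ 2 ≤ B * ‖y‖ ^ 2 :=
    (hsum.sum_le_tsum s fun i _ => by positivity).trans hB
  have hc : 0 ≤ ∑ i ∈ s, ‖c i‖ ^ 2 := Finset.sum_nonneg fun i _ => by positivity
  have h4 : (‖y‖ ^ 2) * ‖y‖ ^ 2 ≤ (B * ∑ i ∈ s, ‖c i‖ ^ 2) * ‖y‖ ^ 2 := by
    calc (‖y‖ ^ 2) * ‖y‖ ^ 2 = (‖y‖ ^ 2) ^ 2 := by ring
      _ ≤ (∑ i ∈ s, ‖c i‖ * ‖inner ℂ (e i) y‖) ^ 2 := by gcongr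
      _ ≤ _ := h2
      _ ≤ (∑ i ∈ s, ‖c i‖ ^ 2) * (B * ‖y‖ ^ 2) := by gcongr
      _ = _ := by ring
  rcases (sq_nonneg ‖y‖).eq_or_lt with h0 | h0
  · rw [← h0]; exact mul_nonneg he.2.1.le hc
  · exact le_of_mul_le_mul_right h4 h0

/-- The synthesis bound transfers the Cauchy property over finite index sets from the squared
coefficients to the vector series, so convergence is unconditional. -/
theorem IsFrame.summable_frameOp [CompleteSpace H] {e : ι → H} {A B : ℝ} (he : IsFrame e A B)
    (f : H) : Summable fun i => (inner ℂ (e i) f : ℂ) • e i := by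
  rw [summable_iff_vanishing_norm]
  intro ε hε
  have hB := he.2.1
  obtain ⟨s, hs⟩ := summable_iff_vanishing_norm.1 (he.2.2 f).1 (ε ^ 2 / B) (by positivity)
  refine ⟨s, fun t ht => ?_⟩
  have h1 := (le_abs_self _).trans_lt (hs t ht)
  rw [lt_div_iff₀ hB, mul_comm] at h1
  exact lt_of_pow_lt_pow_left₀ 2 hε.le ((he.norm_sum_smul_sq_le t _).trans_lt h1)

theorem IsFrame.norm_inner_frameOp [CompleteSpace H] {e : ι → H} {A B : ℝ} (he : IsFrame e A B)
    (f : H) : ‖(inner ℂ f (frameOp e f) : ℂ)‖ = ∑' i, ‖inner ℂ (e i) f‖ ^ 2 := by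
  have h1 := (he.summable_frameOp f).hasSum.mapL (innerSL ℂ f)
  have h2 : (inner ℂ f (frameOp e f) : ℂ) = ((∑' i, ‖inner ℂ (e i) f‖ ^ 2 : ℝ) : ℂ) := by
    rw [Complex.ofReal_tsum]
    refine h1.tsum_eq.symm.trans (tsum_congr fun i => ?_)
    rw [innerSL_apply_apply, inner_smul_right, ← inner_conj_symm f (e i), Complex.mul_conj']
    push_cast
    rfl
  rw [h2, Complex.norm_real, Real.norm_of_nonneg (tsum_nonneg fun i => by positivity)]

end FrameOperator

/-! ### Frame bounds for the system. -/

theorem ennreal_two_mul_le_add_sq (x y : ENNReal) : 2 * (x * y) ≤ x ^ 2 + y ^ 2 := by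
  by_cases hx : x = ⊤
  · simp [hx]
  by_cases hy : y = ⊤
  · simp [hy]
  lift x to NNReal using hx
  lift y to NNReal using hy
  norm_cast
  rw [← mul_assoc]
  exact two_mul_le_add_sq x y

/-- A Schur-type bound: replace `2 |F(x) F(x + mL)|` by the sum of squares, and translate the second
integral by `mL`, which turns `m` into `-m`. Summing over the symmetric set `m ≠ 0` puts all the
weight on `|F(x)|²`, which does not depend on the block. -/
theorem crossEnergy_mul_le {G F : ℝ → ℂ} (hG : AEStronglyMeasurable G volume)
    (hF : AEStronglyMeasurable F volume) (L : ℝ) :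
    crossEnergy L (fun x => (starRingEnd ℂ) (G x) * F x) ≤
      ∫⁻ x, ‖F x‖ₑ ^ 2 * (‖G x‖ₑ * ∑' m : ℤ, if m = 0 then 0 else ‖G (x + m * L)‖ₑ) := by
  have hGm : ∀ c, AEMeasurable (fun x => ‖G (x + c)‖ₑ) := aemeasurable_enorm_translate hG
  have hFm : ∀ c, AEMeasurable (fun x => ‖F (x + c)‖ₑ) := aemeasurable_enorm_translate hF
  have hG0 : AEMeasurable (fun x => ‖G x‖ₑ) := hG.enorm
  have hF0 : AEMeasurable (fun x => ‖F x‖ₑ) := hF.enorm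
  set T : ℤ → ENNReal := fun m => ∫⁻ x, ‖F x‖ₑ ^ 2 * (‖G x‖ₑ * ‖G (x + m * L)‖ₑ) with hT
  have hTm : ∀ m : ℤ, ∫⁻ x, ‖F (x + m * L)‖ₑ ^ 2 * (‖G x‖ₑ * ‖G (x + m * L)‖ₑ) = T (-m) := by
    intro m
    simp only [hT]
    rw [← lintegral_add_right_eq_self
      (fun x => ‖F x‖ₑ ^ 2 * (‖G x‖ₑ * ‖G (x + ((-m : ℤ) : ℝ) * L)‖ₑ)) (m * L)]
    refine lintegral_congr fun x => ?_
    push_cast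
    rw [show x + m * L + -m * L = x by ring]
    ring
  have hl : crossEnergy L (fun x => (starRingEnd ℂ) (G x) * F x) = ∑' m : ℤ, if m = 0 then 0 else
      ∫⁻ x, (‖G x‖ₑ * ‖F x‖ₑ) * (‖G (x + m * L)‖ₑ * ‖F (x + m * L)‖ₑ) := by
    unfold crossEnergy
    simp_rw [← ENNReal.tsum_mul_left, enorm_mul, RCLike.enorm_conj]
    rw [lintegral_tsum]
    · refine tsum_congr fun m => ?_
      split_ifs <;> simp
    · intro m
      split_ifs
      · simp
      · exact (hG0.mul hF0).mul ((hGm _).mul (hFm _))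
  have hr : ∫⁻ x, ‖F x‖ₑ ^ 2 * (‖G x‖ₑ * ∑' m : ℤ, if m = 0 then 0 else ‖G (x + m * L)‖ₑ) =
      ∑' m : ℤ, if m = 0 then 0 else T m := by
    simp_rw [← ENNReal.tsum_mul_left]
    rw [lintegral_tsum]
    · refine tsum_congr fun m => ?_
      split_ifs <;> simp [hT]
    · intro m
      split_ifs
      · simp
      · exact (hF0.pow_const 2).mul (hG0.mul (hGm _))
  rw [hl, hr]
  refine (ENNReal.mul_le_mul_iff_right two_ne_zero ENNReal.ofNat_ne_top).1 ?_
  have hsymm : (∑' m : ℤ, if m = 0 then 0 else T (-m)) = ∑' m : ℤ, if m = 0 then 0 else T m := by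
    rw [← (Equiv.neg ℤ).tsum_eq (fun m => if m = 0 then 0 else T m)]
    simp
  rw [two_mul (∑' m : ℤ, if m = 0 then 0 else T m)]
  nth_rewrite 2 [← hsymm]
  rw [← ENNReal.tsum_add, ← ENNReal.tsum_mul_left]
  refine ENNReal.tsum_le_tsum fun m => ?_
  split_ifs
  · simp
  rw [← hTm, hT, ← lintegral_const_mul' _ _ ENNReal.ofNat_ne_top, ← lintegral_add_left']
  · refine lintegral_mono fun x => ?_
    calc 2 * (‖G x‖ₑ * ‖F x‖ₑ * (‖G (x + m * L)‖ₑ * ‖F (x + m * L)‖ₑ))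
        = 2 * (‖F x‖ₑ * ‖F (x + m * L)‖ₑ) * (‖G x‖ₑ * ‖G (x + m * L)‖ₑ) := by ring
      _ ≤ (‖F x‖ₑ ^ 2 + ‖F (x + m * L)‖ₑ ^ 2) * (‖G x‖ₑ * ‖G (x + m * L)‖ₑ) := by
        gcongr; exact ennreal_two_mul_le_add_sq _ _
      _ = _ := by rw [add_mul]
  · exact (hF0.pow_const 2).mul (hG0.mul (hGm _))

theorem lintegral_enorm_sq_eq (f : Lp ℂ 2 (volume : Measure ℝ)) :
    ∫⁻ x, ‖f x‖ₑ ^ 2 = ENNReal.ofReal (‖f‖ ^ 2) := by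
  rw [ENNReal.ofReal_pow (norm_nonneg _), ofReal_norm, Lp.enorm_def,
    eLpNorm_eq_lintegral_rpow_enorm_toReal (by norm_num) (by norm_num)]
  simp only [ENNReal.toReal_ofNat, ENNReal.rpow_ofNat]
  rw [← ENNReal.rpow_natCast, ← ENNReal.rpow_mul]
  norm_num

/-- The frame sum over one frequency block, compared with its diagonal part. -/
theorem tsum_enorm_inner_system_bounds {φ : ℝ → ℂ} (hφ : Integrable φ) (hφ2 : MemLp φ 2 volume)
    {μ ν α b : ℝ} (hα : 0 ≤ α) (hν : 0 < ν) (p : ℤ)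
    (hb : ∀ ω, ‖Phi φ μ α p ω‖ ^ 2 ≤ b)
    (f F : Lp ℂ 2 (volume : Measure ℝ)) (hF : F = 𝓕 f) {E : ENNReal}
    (hE : ∫⁻ x, ‖F x‖ₑ ^ 2 * (‖Phi φ μ α p x‖ₑ *
      ∑' m : ℤ, if m = 0 then 0 else ‖Phi φ μ α p (x + m * (beta α p / ν))‖ₑ) = E)
    (hE_top : E ≠ ⊤) :
    ∑' k : ℤ, ‖inner ℂ (system φ hφ2 μ ν α (p, k)) f‖ₑ ^ 2 ≤
      ENNReal.ofReal (1 / ν) * ((∫⁻ x, ‖F x‖ₑ ^ 2 * ‖Phi φ μ α p x‖ₑ ^ 2) + E) ∧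
    ENNReal.ofReal (1 / ν) * ∫⁻ x, ‖F x‖ₑ ^ 2 * ‖Phi φ μ α p x‖ₑ ^ 2 ≤
      ∑' k : ℤ, ‖inner ℂ (system φ hφ2 μ ν α (p, k)) f‖ₑ ^ 2 + ENNReal.ofReal (1 / ν) * E := by
  set L : ℝ := beta α p / ν with hLdef
  have hβ : (0 : ℝ) < beta α p := by exact_mod_cast one_le_beta hα p
  have hL : 0 < L := by positivity
  have hΦ : AEStronglyMeasurable (Phi φ μ α p) volume :=
    (continuous_Phi hφ μ α p).aestronglyMeasurable
  have hΦc : AEStronglyMeasurable (fun x => (starRingEnd ℂ) (Phi φ μ α p x)) volume :=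
    (Complex.continuous_conj.comp (continuous_Phi hφ μ α p)).aestronglyMeasurable
  set g : ℝ → ℂ := fun x => (starRingEnd ℂ) (Phi φ μ α p x) * F x with hg
  have hgi : Integrable g :=
    ((memLp_congr_norm hΦc hΦ (Filter.Eventually.of_forall fun x => by simp)).2
      (memLp_Phi hφ hφ2 μ α p)).integrable_mul (Lp.memLp F)
  have hg2 : MemLp g 2 volume := by
    refine (Lp.memLp F).of_le_mul (c := Real.sqrt b) hgi.1 (Filter.Eventually.of_forall fun x => ?_)
    rw [hg, norm_mul, RCLike.norm_conj]
    gcongr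
    exact Real.le_sqrt_of_sq_le (hb x)
  have hcross : crossEnergy L g ≤ E := hE ▸ crossEnergy_mul_le hΦ (Lp.memLp F).1 L
  obtain ⟨h1, h2⟩ := tsum_enorm_sq_integral_exp_mul_bounds hL hgi hg2
    (ne_top_of_le_ne_top hE_top hcross)
  have hgsq : ∫⁻ x, ‖g x‖ₑ ^ 2 = ∫⁻ x, ‖F x‖ₑ ^ 2 * ‖Phi φ μ α p x‖ₑ ^ 2 := by
    refine lintegral_congr fun x => ?_
    rw [hg, enorm_mul, RCLike.enorm_conj, mul_pow, mul_comm]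
  rw [hgsq] at h1 h2
  have hS : ∑' k : ℤ, ‖inner ℂ (system φ hφ2 μ ν α (p, k)) f‖ₑ ^ 2 = ENNReal.ofReal (1 / beta α p) *
      ∑' k : ℤ, ‖∫ x, Complex.exp (2 * Real.pi * Complex.I * ((k / L * x : ℝ) : ℂ)) * g x‖ₑ ^ 2 := by
    rw [← ENNReal.tsum_mul_left]
    refine tsum_congr fun k => ?_
    rw [inner_system hφ, enorm_mul, mul_pow, ← hF]
    congr 1
    · rw [← ofReal_norm, Complex.norm_real, ← ENNReal.ofReal_pow (norm_nonneg _),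
        Real.norm_eq_abs, sq_abs, div_pow, Real.sq_sqrt hβ.le, one_pow]
    · rw [hLdef, div_div_eq_mul_div]
  -- The block width cancels against the period, leaving the same factor `1 / ν` for every `p`.
  have hc : ENNReal.ofReal (1 / beta α p) * ENNReal.ofReal L = ENNReal.ofReal (1 / ν) := by
    rw [← ENNReal.ofReal_mul (by positivity), hLdef]
    congr 1
    field_simp
  rw [hS, ← hc]
  constructor
  · rw [mul_assoc (ENNReal.ofReal (1 / (beta α p : ℝ)))]
    gcongr ENNReal.ofReal (1 / (beta α p : ℝ)) * ?_
    exact h1.trans (by gcongr)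
  · rw [mul_assoc (ENNReal.ofReal (1 / (beta α p : ℝ))),
      mul_assoc (ENNReal.ofReal (1 / (beta α p : ℝ))), ← mul_add]
    gcongr ENNReal.ofReal (1 / (beta α p : ℝ)) * ?_
    exact h2.trans (by gcongr)

theorem tsum_enorm_sq_bounds {a b : ℝ} {x : ℤ → ℂ}
    (hs : Summable fun p => ‖x p‖ ^ 2) (hl : a ≤ ∑' p, ‖x p‖ ^ 2) (hu : ∑' p, ‖x p‖ ^ 2 ≤ b) :
    ENNReal.ofReal a ≤ ∑' p, ‖x p‖ₑ ^ 2 ∧ ∑' p, ‖x p‖ₑ ^ 2 ≤ ENNReal.ofReal b := by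
  have : ∑' p, ‖x p‖ₑ ^ 2 = ENNReal.ofReal (∑' p, ‖x p‖ ^ 2) := by
    rw [ENNReal.ofReal_tsum_of_nonneg (fun p => by positivity) hs]
    refine tsum_congr fun p => ?_
    rw [ENNReal.ofReal_pow (norm_nonneg _), ofReal_norm]
  rw [this]
  exact ⟨ENNReal.ofReal_le_ofReal hl, ENNReal.ofReal_le_ofReal hu⟩

theorem isFrame_system {φ : ℝ → ℂ} (hφ : Integrable φ) (hφ2 : MemLp φ 2 volume)
    {μ ν α a b : ℝ} (ha : 0 < a) (hb : 0 < b) (hα : 0 ≤ α) (hν : 0 < ν)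
    (hΦ : ∀ ω : ℝ, Summable (fun p : ℤ => ‖Phi φ μ α p ω‖ ^ 2) ∧
      a ≤ ∑' p : ℤ, ‖Phi φ μ α p ω‖ ^ 2 ∧ ∑' p : ℤ, ‖Phi φ μ α p ω‖ ^ 2 ≤ b)
    (hoff : ∀ ω : ℝ, ∑' p : ℤ, ‖Phi φ μ α p ω‖ₑ *
        (∑' m : ℤ, if m = 0 then 0 else ‖Phi φ μ α p (ω + m * (beta α p / ν))‖ₑ) ≤
      ENNReal.ofReal (a / 2)) :
    IsFrame (system φ hφ2 μ ν α) (a / (2 * ν)) ((b + a / 2) / ν) := by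
  refine ⟨by positivity, by positivity, fun f => ?_⟩
  set F : Lp ℂ 2 (volume : Measure ℝ) := 𝓕 f with hF
  set W : ENNReal := ENNReal.ofReal (‖f‖ ^ 2) with hW
  have hFW : ∫⁻ x, ‖F x‖ₑ ^ 2 = W := by rw [lintegral_enorm_sq_eq, hF, Lp.norm_fourier_eq]
  have hF2 : AEMeasurable (fun x => ‖F x‖ₑ ^ 2) := (Lp.memLp F).1.enorm.pow_const 2
  have hΦm : ∀ p, AEStronglyMeasurable (Phi φ μ α p) volume := fun p =>
    (continuous_Phi hφ μ α p).aestronglyMeasurable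
  set E : ℤ → ENNReal := fun p => ∫⁻ x, ‖F x‖ₑ ^ 2 * (‖Phi φ μ α p x‖ₑ *
      ∑' m : ℤ, if m = 0 then 0 else ‖Phi φ μ α p (x + m * (beta α p / ν))‖ₑ) with hE
  set M : ℤ → ENNReal := fun p => ∫⁻ x, ‖F x‖ₑ ^ 2 * ‖Phi φ μ α p x‖ₑ ^ 2 with hM
  have hEle : ∑' p, E p ≤ ENNReal.ofReal (a / 2) * W := by
    refine (lintegral_tsum fun p => hF2.fun_mul
      ((hΦm p).enorm.fun_mul (aemeasurable_tsum_translate (hΦm p) _))).symm.trans_le ?_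
    simp_rw [ENNReal.tsum_mul_left]
    rw [← hFW, ← lintegral_const_mul'' _ hF2]
    refine lintegral_mono fun x => ?_
    dsimp only
    rw [mul_comm]
    gcongr
    exact hoff x
  have hMsum : ∑' p, M p = ∫⁻ x, ‖F x‖ₑ ^ 2 * ∑' p, ‖Phi φ μ α p x‖ₑ ^ 2 := by
    refine (lintegral_tsum fun p =>
      hF2.fun_mul ((hΦm p).enorm.pow_const 2)).symm.trans ?_
    simp_rw [ENNReal.tsum_mul_left]
  have hpt := fun x => tsum_enorm_sq_bounds (hΦ x).1 (hΦ x).2.1 (hΦ x).2.2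
  have hMl : ENNReal.ofReal a * W ≤ ∑' p, M p := by
    rw [hMsum, ← hFW, ← lintegral_const_mul'' _ hF2]
    refine lintegral_mono fun x => ?_
    dsimp only
    rw [mul_comm]
    gcongr
    exact (hpt x).1
  have hMu : ∑' p, M p ≤ ENNReal.ofReal b * W := by
    rw [hMsum, ← hFW, ← lintegral_const_mul'' _ hF2]
    refine lintegral_mono fun x => ?_
    dsimp only
    rw [mul_comm (ENNReal.ofReal b)]
    gcongr
    exact (hpt x).2
  have hEtop : ∀ p, E p ≠ ⊤ := fun p => ne_top_of_le_ne_top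
    (ENNReal.mul_ne_top ENNReal.ofReal_ne_top ENNReal.ofReal_ne_top)
    ((ENNReal.le_tsum p).trans hEle)
  have hblock := fun p => tsum_enorm_inner_system_bounds hφ hφ2 hα hν p
    (fun ω => ((hΦ ω).1.le_tsum p fun _ _ => by positivity).trans (hΦ ω).2.2) f F hF
    (rfl : E p = E p) (hEtop p)
  set Q : ENNReal := ∑' q : ℤ × ℤ, ‖inner ℂ (system φ hφ2 μ ν α q) f‖ₑ ^ 2 with hQ
  have hQp : Q = ∑' p : ℤ, ∑' k : ℤ, ‖inner ℂ (system φ hφ2 μ ν α (p, k)) f‖ₑ ^ 2 :=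
    ENNReal.tsum_prod'
  have hQu : Q ≤ ENNReal.ofReal ((b + a / 2) / ν * ‖f‖ ^ 2) := by
    rw [hQp]
    calc _ ≤ ∑' p, ENNReal.ofReal (1 / ν) * (M p + E p) :=
          ENNReal.tsum_le_tsum fun p => (hblock p).1
      _ = ENNReal.ofReal (1 / ν) * (∑' p, M p + ∑' p, E p) := by
          rw [ENNReal.tsum_mul_left, ENNReal.tsum_add]
      _ ≤ ENNReal.ofReal (1 / ν) * (ENNReal.ofReal b * W + ENNReal.ofReal (a / 2) * W) := by
          gcongr
      _ = _ := by
          rw [← add_mul, ← ENNReal.ofReal_add hb.le (by positivity), hW, ← mul_assoc,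
            ← ENNReal.ofReal_mul (by positivity), ← ENNReal.ofReal_mul (by positivity)]
          congr 1
          ring
  -- The error stays on the right because subtraction truncates in `ENNReal`; it is moved over in
  -- `ℝ` once `Q` is known to be finite.
  have hQl : ENNReal.ofReal (a / ν * ‖f‖ ^ 2) ≤ Q + ENNReal.ofReal (a / (2 * ν) * ‖f‖ ^ 2) := by
    rw [hQp]
    calc _ = ENNReal.ofReal (1 / ν) * (ENNReal.ofReal a * W) := by
          rw [hW, ← ENNReal.ofReal_mul ha.le, ← ENNReal.ofReal_mul (by positivity)]
          congr 1
          ring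
      _ ≤ ENNReal.ofReal (1 / ν) * ∑' p, M p := by gcongr
      _ ≤ ∑' p, (∑' k : ℤ, ‖inner ℂ (system φ hφ2 μ ν α (p, k)) f‖ₑ ^ 2 +
            ENNReal.ofReal (1 / ν) * E p) := by
          rw [← ENNReal.tsum_mul_left]
          exact ENNReal.tsum_le_tsum fun p => (hblock p).2
      _ = ∑' p, ∑' k : ℤ, ‖inner ℂ (system φ hφ2 μ ν α (p, k)) f‖ₑ ^ 2 +
            ENNReal.ofReal (1 / ν) * ∑' p, E p := by
          rw [ENNReal.tsum_add, ENNReal.tsum_mul_left]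
      _ ≤ ∑' p, ∑' k : ℤ, ‖inner ℂ (system φ hφ2 μ ν α (p, k)) f‖ₑ ^ 2 +
            ENNReal.ofReal (1 / ν) * (ENNReal.ofReal (a / 2) * W) := by gcongr
      _ = _ := by
          congr 1
          rw [hW, ← ENNReal.ofReal_mul (by positivity), ← ENNReal.ofReal_mul (by positivity)]
          congr 1
          field_simp
  have hQtop : Q ≠ ⊤ := ne_top_of_le_ne_top ENNReal.ofReal_ne_top hQu
  have hsum : Summable fun q => ‖inner ℂ (system φ hφ2 μ ν α q) f‖ ^ 2 := by
    have := ENNReal.summable_toReal hQtop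
    simpa using this
  have hQr : Q = ENNReal.ofReal (∑' q, ‖inner ℂ (system φ hφ2 μ ν α q) f‖ ^ 2) := by
    rw [ENNReal.ofReal_tsum_of_nonneg (fun q => by positivity) hsum, hQ]
    refine tsum_congr fun q => ?_
    rw [ENNReal.ofReal_pow (norm_nonneg _), ofReal_norm]
  have hnn : 0 ≤ ∑' q, ‖inner ℂ (system φ hφ2 μ ν α q) f‖ ^ 2 := tsum_nonneg fun q => by positivity
  refine ⟨hsum, ?_, ?_⟩
  · rw [hQr, ← ENNReal.ofReal_add hnn (by positivity),
      ENNReal.ofReal_le_ofReal_iff (by positivity)] at hQl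
    have : a / ν * ‖f‖ ^ 2 = 2 * (a / (2 * ν) * ‖f‖ ^ 2) := by field_simp
    linarith
  · rwa [hQr, ENNReal.ofReal_le_ofReal_iff (by positivity)] at hQu

theorem exists_mul_rpow_le {D s ε μ : ℝ} (hD : 0 ≤ D) (hs : 0 < s) (hε : 0 < ε) (hμ : 0 < μ) :
    ∃ ν₀ : ℝ, 0 < ν₀ ∧ ∀ ν, 0 < ν → ν < ν₀ → 2 * μ * ν ≤ 1 ∧ D * (2 * ν) ^ s ≤ ε := by
  -- The first bound separates the shifted blocks; the second solves `(D + 1) (2ν)^s ≤ ε`, with `D +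
  -- 1` in place of `D` in case `D = 0`.
  refine ⟨min (1 / (2 * μ)) ((ε / (D + 1)) ^ s⁻¹ / 2), by positivity, fun ν h0 hν => ⟨?_, ?_⟩⟩
  · have := (hν.trans_le (min_le_left _ _)).le
    rw [le_div_iff₀ (by positivity)] at this
    linarith
  · have h1 : 2 * ν ≤ (ε / (D + 1)) ^ s⁻¹ := by
      have := (hν.trans_le (min_le_right _ _)).le
      linarith
    have h2 : (2 * ν) ^ s ≤ ε / (D + 1) := by
      calc (2 * ν) ^ s ≤ ((ε / (D + 1)) ^ s⁻¹) ^ s := by gcongr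
        _ = _ := Real.rpow_inv_rpow (by positivity) hs.ne'
    calc D * (2 * ν) ^ s ≤ (D + 1) * (ε / (D + 1)) := by gcongr; linarith
      _ = ε := by field_simp

end DOST

theorem theoremT
    (φ : ℝ → ℂ) (hφ1 : Integrable φ (volume : Measure ℝ))
    (hφ2 : MemLp φ 2 (volume : Measure ℝ))
    (N C : ℝ) (hN : 2 < N)
    (hdecay : ∀ ω : ℝ, ‖𝓕 φ ω‖ ≤ C / (1 + |ω|) ^ N)
    (μ : ℝ) (hμ : 0 < μ) (a b : ℝ) (ha : 0 < a) (hb : 0 < b) :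
    ∃ ν₀ : ℝ, 0 < ν₀ ∧
      ∀ α : ℝ, α ∈ Set.Icc (0 : ℝ) 1 →
        (∀ ω : ℝ, Summable (fun p : ℤ => ‖DOST.Phi φ μ α p ω‖ ^ 2) ∧
          a ≤ ∑' p : ℤ, ‖DOST.Phi φ μ α p ω‖ ^ 2 ∧
          ∑' p : ℤ, ‖DOST.Phi φ μ α p ω‖ ^ 2 ≤ b) →
        ∀ ν : ℝ, 0 < ν → ν < ν₀ →
          DOST.IsFrame (DOST.system φ hφ2 μ ν α) (a / (2 * ν)) ((b + a / 2) / ν) ∧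
          ∀ f : Lp ℂ 2 (volume : Measure ℝ),
            Summable (fun q : ℤ × ℤ =>
              (inner ℂ (DOST.system φ hφ2 μ ν α q) f : ℂ) • DOST.system φ hφ2 μ ν α q) ∧
            a / (2 * ν) * ‖f‖ ^ 2 ≤
              ‖(inner ℂ f (DOST.frameOp (DOST.system φ hφ2 μ ν α) f) : ℂ)‖ ∧
            ‖(inner ℂ f (DOST.frameOp (DOST.system φ hφ2 μ ν α) f) : ℂ)‖ ≤
              (b + a / 2) / ν * ‖f‖ ^ 2 := by
  obtain ⟨D, hD, hDle⟩ := DOST.exists_tsum_Phi_mul_translate_le hN hdecay hμ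
  obtain ⟨ν₀, hν₀, hsmall⟩ := DOST.exists_mul_rpow_le hD (by linarith : 0 < N / 2)
    (by positivity : 0 < a / 2) hμ
  refine ⟨ν₀, hν₀, fun α hα hΦ ν hν hνlt => ?_⟩
  obtain ⟨h1, h2⟩ := hsmall ν hν hνlt
  have hframe := DOST.isFrame_system hφ1 hφ2 ha hb hα.1 hν hΦ fun ω =>
    (hDle α hα.1 ν hν h1 ω).trans (ENNReal.ofReal_le_ofReal h2)
  refine ⟨hframe, fun f => ⟨hframe.summable_frameOp f, ?_⟩⟩
  rw [hframe.norm_inner_frameOp]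
  exact (hframe.2.2 f).2
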